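/- Let $\mathcal X$ be a measurable space (for instance a topological space with its Borel $\sigma$-algebra), let $\mathcal F_k$ be a reproducing kernel Hilbert space of real functions on $\mathcal X$ with reproducing kernel $k$, and let $P\neq Q$ be probability measures on $\mathcal X$ that have mean embeddings $\mu_k(P),\mu_k(Q)\in\mathcal F_k$, i.e. every $f\in\mathcal F_k$ is integrable under $P$ and $Q$, with $E_{x\sim P}f(x)=\langle f,\mu_k(P)\rangle$ and $E_{y\sim Q}f(y)=\langle f,\mu_k(Q)\rangle$. Put $\mathrm{MMD}^2=\|\mu_k(P)-\mu_k(Q)\|_{\mathcal F_k}^2$ and, for $z=(x,y)$, $z'=(x',y')$, $$h(z,z')=k(x,x')+k(y,y')-k(x,y')-k(x',y).$$ Let $z_1,z_2,\dots$ be i.i.d. with law $P\otimes Q$. For a sample size $n$ and a block size $B$, let $$\hat\eta_k(i)=\frac1{B(B-1)}\sum_{a=(i-1)B+1}^{iB}\ \sum_{\substack{b=(i-1)B+1\\ b\ne a}}^{iB}h(z_a,z_b),\qquad \hat\eta_k=\frac1{\lfloor n/B\rfloor}\sum_{i=1}^{\lfloor n/B\rfloor}\hat\eta_k(i).$$ Assume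 $0<E[h(z,z')^2]<\infty$ for independent $z,z'\sim P\otimes Q$, and put $$\sigma_u^2=4\Bigl(E_z\bigl[(E_{z'}h(z,z'))^2\bigr]-\bigl(E_{z,z'}h(z,z')\bigr)^2\Bigr).$$ Then $\hat\eta_k$ is asymptotically $\mathcal N(\mathrm{MMD}^2,\sigma_u^2n^{-1})$ whenever $B\to\infty$ and $n/B\to\infty$: for all sequences $(n_j)$ and $(B_j)$ of natural numbers with $B_j\to\infty$ and $n_j/B_j\to\infty$, the statistics $\hat\eta_k$ with sample size $n_j$ and block size $B_j$ satisfy $$\sqrt{n_j}\,\bigl(\hat\eta_k-\mathrm{MMD}^2\bigr)\ \xrightarrow{\ D\ }\ \mathcal N(0,\sigma_u^2)\qquad(j\to\infty),$$ where $\mathcal N(0,0)$ is the point mass at $0$. In particular the limiting variance does not depend on the choice of the block sizes. -/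

import Mathlib

open MeasureTheory ProbabilityTheory Filter Topology

noncomputable section

namespace BTest

section Kernel

variable {X : Type*} (H : Type*) [NormedAddCommGroup H] [InnerProductSpace ℝ H]
  [CompleteSpace H] [RKHS ℝ H X ℝ]

/-- The (real valued) reproducing kernel `k(x, x')` of the reproducing kernel Hilbert space `H`
of real functions on `X`. Mathlib's kernel takes values in the continuous linear maps
`ℝ →L[ℝ] ℝ`, which are identified with their value at `1`. -/
def ker (x x' : X) : ℝ := RKHS.kernel H x x' 1

/-- `h(z, z') = k(x, x') + k(y, y') - k(x, y') - k(x', y)` for `z = (x, y)`, `z' = (x', y')`. -/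
def mmdCore (z z' : X × X) : ℝ :=
  ker H z.1 z'.1 + ker H z.2 z'.2 - ker H z.1 z'.2 - ker H z'.1 z.2

end Kernel

section MeanEmbedding

variable {X : Type*} [MeasurableSpace X] {H : Type*} [NormedAddCommGroup H]
  [InnerProductSpace ℝ H] [RKHS ℝ H X ℝ]

/-- `m ∈ H` is a mean embedding of `P`: every `f ∈ H` is `P`-integrable and
`E_{x ∼ P} f(x) = ⟨f, m⟩`. -/
def IsMeanEmbedding (P : Measure X) (m : H) : Prop :=
  ∀ f : H, Integrable (fun x => f x) P ∧ ∫ x, f x ∂P = inner ℝ f m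

theorem IsMeanEmbedding.unique {P : Measure X} {m m' : H}
    (hm : IsMeanEmbedding P m) (hm' : IsMeanEmbedding P m') : m = m' :=
  ext_inner_left ℝ fun f => (hm f).2.symm.trans (hm' f).2

variable (H)

/-- The measure `P` has a mean embedding in `H`. -/
def HasMeanEmbedding (P : Measure X) : Prop := ∃ m : H, IsMeanEmbedding P m

open Classical in
/-- The mean embedding of `P` in `H` (with the value `0` if there is none). -/
def meanEmbedding (P : Measure X) : H :=
  if hP : HasMeanEmbedding H P then hP.choose else 0

variable {H} in
theorem IsMeanEmbedding.meanEmbedding_eq {P : Measure X} {m : H} (hm : IsMeanEmbedding P m) :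
    meanEmbedding H P = m := by
  have hP : HasMeanEmbedding H P := ⟨m, hm⟩
  rw [meanEmbedding, dif_pos hP]
  exact hP.choose_spec.unique hm

/-- The squared maximum mean discrepancy: the squared distance in `H` between the mean
embeddings of `P` and `Q`. -/
def mmdSq (P Q : Measure X) : ℝ := ‖meanEmbedding H P - meanEmbedding H Q‖ ^ 2

end MeanEmbedding

section Statistic

variable {S : Type*}

/-- The U-statistic with core `h` on the `i`-th block (`i = 0, 1, …`) of `B` consecutive
observations, namely those with indices `i * B, …, (i + 1) * B - 1`. -/
def blockStat (h : S → S → ℝ) (B : ℕ) (z : ℕ → S) (i : ℕ) : ℝ :=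
  1 / ((B : ℝ) * ((B : ℝ) - 1)) *
    ∑ a ∈ Finset.Ico (i * B) ((i + 1) * B),
      ∑ b ∈ (Finset.Ico (i * B) ((i + 1) * B)).erase a, h (z a) (z b)

/-- The average of the block statistics over the `⌊n / B⌋` complete blocks of size `B` among the
first `n` observations. -/
def blockAverage (h : S → S → ℝ) (n B : ℕ) (z : ℕ → S) : ℝ :=
  1 / ((n / B : ℕ) : ℝ) * ∑ i ∈ Finset.range (n / B), blockStat h B z i

/-- `σ_u² = 4 (E_z[(E_{z'} h(z, z'))²] - (E_{z, z'} h(z, z'))²)`, for `z, z'` independent with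
law `ρ`. -/
def sigmaSq [MeasurableSpace S] (h : S → S → ℝ) (ρ : Measure S) : ℝ :=
  4 * (∫ z, (∫ z', h z z' ∂ρ) ^ 2 ∂ρ - (∫ z, ∫ z', h z z' ∂ρ ∂ρ) ^ 2)

end Statistic

end BTest

end

/-!
The argument is the Hoeffding decomposition of the core. Write `ρ = P ⊗ Q`, `θ = E h(z, z')`,
`g(z) = E_{z'} h(z, z')` and `h(z, z') = g(z) + g(z') - θ + w(z, z')`. The remainder `w` is symmetric
and degenerate: it integrates to zero in each variable. On `M = ⌊n / B⌋` complete blocks, with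
`N = M B` observations, the block average of `h` is therefore

  `θ + (2 / N) ∑_{k < N} (g(z_k) - θ) + (block average of w)`

(`blockAverage_eq_add`). The blocks thus play no role in the linear term, whose rescaling by `√N`
converges to `N(0, 4 Var g) = N(0, σ_u²)` by the classical central limit theorem; since `n / N → 1`
(`tendsto_sampleSize_ratio`), Slutsky's theorem allows `√n` instead of `√N`.

The degenerate term is negligible. The variables `w(z_a, z_b)` belonging to different unordered
pairs of indices are orthogonal (`integral_mul_eq_zero_of_ne`), so that the block average of `w`,
which runs over `M B (B - 1)` ordered pairs, has second moment at most `2 E w² / (M B (B - 1))`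
(`integral_sq_sum_le`). After multiplication by `n` this tends to zero because `B → ∞`
(`tendstoInMeasure_sqrt_mul_blockAverage`).

All this holds for every symmetric square integrable core (`tendstoInDistribution_blockAverage`).
The reproducing kernel Hilbert space only enters through the identity `θ = MMD²`: by the
reproducing property `g(x, y) = f(x) - f(y)` with `f = μ_k(P) - μ_k(Q)`, and integrating once more
gives `⟨f, f⟩` (`integral_integral_mmdCore`).
-/

namespace BTest

/-! ### The core in terms of mean embeddings -/

section RKHS

variable {X : Type*} {H : Type*} [NormedAddCommGroup H] [InnerProductSpace ℝ H]
  [CompleteSpace H] [RKHS ℝ H X ℝ]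

theorem kerFun_one_apply (x x' : X) : (RKHS.kerFun H x' 1) x = ker H x x' :=
  RKHS.kerFun_apply H x' 1 x

theorem inner_kerFun_one (f : H) (x : X) : inner ℝ f (RKHS.kerFun H x (1 : ℝ)) = f x := by
  rw [RKHS.inner_kerFun]; simp

theorem ker_comm (x x' : X) : ker H x x' = ker H x' x := by
  rw [← kerFun_one_apply, ← kerFun_one_apply, ← inner_kerFun_one, ← inner_kerFun_one,
    real_inner_comm]

theorem mmdCore_comm (z z' : X × X) : mmdCore H z z' = mmdCore H z' z := by
  simp only [mmdCore, ker_comm z'.1 z.1, ker_comm z'.2 z.2]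
  ring

variable [MeasurableSpace X]

theorem IsMeanEmbedding.integrable_ker {P : Measure X} {m : H} (hm : IsMeanEmbedding P m)
    (x : X) : Integrable (fun x' => ker H x x') P := by
  simpa only [ker_comm x, kerFun_one_apply] using (hm (RKHS.kerFun H x 1)).1

theorem IsMeanEmbedding.integral_ker {P : Measure X} {m : H} (hm : IsMeanEmbedding P m)
    (x : X) : ∫ x', ker H x x' ∂P = m x := by
  have h := (hm (RKHS.kerFun H x 1)).2
  rw [real_inner_comm, inner_kerFun_one] at h
  simpa only [ker_comm x, kerFun_one_apply] using h

/-- The one-variable projection of the core is the witness function `μ_k(P) - μ_k(Q)`, evaluated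
at the first point minus at the second point. -/
theorem integral_mmdCore {P Q : Measure X} [IsProbabilityMeasure P] [IsProbabilityMeasure Q]
    {m m' : H} (hm : IsMeanEmbedding P m) (hm' : IsMeanEmbedding Q m') (z : X × X) :
    ∫ z', mmdCore H z z' ∂(P.prod Q) = (m - m') z.1 - (m - m') z.2 := by
  have hP (x : X) : Integrable (fun p : X × X => ker H x p.1) (P.prod Q) :=
    (hm.integrable_ker x).comp_fst Q
  have hQ (x : X) : Integrable (fun p : X × X => ker H x p.2) (P.prod Q) :=
    (hm'.integrable_ker x).comp_snd P
  have iP (x : X) : ∫ p : X × X, ker H x p.1 ∂(P.prod Q) = m x := by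
    rw [integral_fun_fst (fun p => ker H x p), hm.integral_ker]; simp
  have iQ (x : X) : ∫ p : X × X, ker H x p.2 ∂(P.prod Q) = m' x := by
    rw [integral_fun_snd (fun p => ker H x p), hm'.integral_ker]; simp
  simp only [mmdCore, ker_comm _ z.2]
  have h1 : Integrable (fun p : X × X => ker H z.1 p.1 + ker H z.2 p.2) (P.prod Q) :=
    (hP _).add (hQ _)
  have h2 : Integrable (fun p : X × X => ker H z.1 p.1 + ker H z.2 p.2 - ker H z.1 p.2)
      (P.prod Q) := h1.sub (hQ _)
  rw [integral_sub h2 (hP _), integral_sub h1 (hQ _), integral_add (hP _) (hQ _),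
    iP, iP, iQ, iQ]
  simp only [RKHS.coe_sub, Pi.sub_apply]
  ring

/-- The U-statistic with core `mmdCore` is unbiased for the squared maximum mean discrepancy. -/
theorem integral_integral_mmdCore {P Q : Measure X} [IsProbabilityMeasure P]
    [IsProbabilityMeasure Q] (hP : HasMeanEmbedding H P) (hQ : HasMeanEmbedding H Q) :
    ∫ z, ∫ z', mmdCore H z z' ∂(P.prod Q) ∂(P.prod Q) = mmdSq H P Q := by
  obtain ⟨m, hm⟩ := hP
  obtain ⟨m', hm'⟩ := hQ
  simp_rw [integral_mmdCore hm hm']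
  rw [integral_sub ((hm (m - m')).1.comp_fst Q) ((hm' (m - m')).1.comp_snd P),
    integral_fun_fst (fun p => (m - m') p), integral_fun_snd (fun p => (m - m') p),
    (hm _).2, (hm' _).2, mmdSq, hm.meanEmbedding_eq, hm'.meanEmbedding_eq,
    ← real_inner_self_eq_norm_sq, inner_sub_right (m - m')]
  simp

end RKHS

/-! ### Second moments of degenerate U-statistics -/

section Orthogonality

variable {S Ω : Type*} [MeasurableSpace S] [MeasurableSpace Ω] {ρ : Measure S}
  {μ : Measure Ω} [IsProbabilityMeasure μ] {Z : ℕ → Ω → S}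

theorem hasLaw_pair (hind : iIndepFun Z μ) (hlaw : ∀ i, HasLaw (Z i) ρ μ) {a b : ℕ}
    (hab : a ≠ b) : HasLaw (fun ω => (Z a ω, Z b ω)) (ρ.prod ρ) μ :=
  (hind.indepFun hab).hasLaw_prod (hlaw a) (hlaw b)

theorem memLp_pair (hind : iIndepFun Z μ) (hlaw : ∀ i, HasLaw (Z i) ρ μ) {u : S → S → ℝ}
    (hu : MemLp (fun p : S × S => u p.1 p.2) 2 (ρ.prod ρ)) {a b : ℕ} (hab : a ≠ b) :
    MemLp (fun ω => u (Z a ω) (Z b ω)) 2 μ := by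
  have h := hasLaw_pair hind hlaw hab
  rw [← h.map_eq] at hu
  exact (memLp_map_measure_iff hu.1 h.aemeasurable).1 hu

variable [IsProbabilityMeasure ρ]

/-- If `u` integrates to zero in its second variable, then `u(Z_b, Z_i)` is orthogonal to every
square integrable function of `Z_c` and `Z_d`, where `i ∉ {b, c, d}`: integrate over the
independent coordinate `Z_i` first. -/
theorem integral_mul_eq_zero_of_degenerate (hind : iIndepFun Z μ)
    (hlaw : ∀ i, HasLaw (Z i) ρ μ) {u v : S → S → ℝ}
    (hu : MemLp (fun p : S × S => u p.1 p.2) 2 (ρ.prod ρ))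
    (hv : MemLp (fun p : S × S => v p.1 p.2) 2 (ρ.prod ρ))
    (hdeg : ∀ᵐ y ∂ρ, ∫ x, u y x ∂ρ = 0) {i b c d : ℕ} (hib : i ≠ b) (hic : i ≠ c) (hid : i ≠ d)
    (hcd : c ≠ d) : ∫ ω, u (Z b ω) (Z i ω) * v (Z c ω) (Z d ω) ∂μ = 0 := by
  -- The pairs `(Z_b, Z_i)` and `(Z_c, Z_d)` have law `ρ ⊗ ρ`, so that `u` and `v` may be replaced
  -- by measurable versions; the joint law of all the variables involved need not be a product.
  set u' := hu.1.mk
  set v' := hv.1.mk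
  have mu' : Measurable u' := hu.1.stronglyMeasurable_mk.measurable
  have mv' : Measurable v' := hv.1.stronglyMeasurable_mk.measurable
  have hbi := hasLaw_pair hind hlaw hib.symm
  have hcd' := hasLaw_pair hind hlaw hcd
  have eu : ∀ᵐ ω ∂μ, u (Z b ω) (Z i ω) = u' (Z b ω, Z i ω) :=
    ae_of_ae_map (p := fun q : S × S => u q.1 q.2 = u' q) hbi.aemeasurable
      (by rw [hbi.map_eq]; exact hu.1.ae_eq_mk)
  have ev : ∀ᵐ ω ∂μ, v (Z c ω) (Z d ω) = v' (Z c ω, Z d ω) :=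
    ae_of_ae_map (p := fun q : S × S => v q.1 q.2 = v' q) hcd'.aemeasurable
      (by rw [hcd'.map_eq]; exact hv.1.ae_eq_mk)
  have hdeg' : ∀ᵐ y ∂ρ, ∫ x, u' (y, x) ∂ρ = 0 := by
    filter_upwards [hdeg, Measure.ae_ae_of_ae_prod hu.1.ae_eq_mk] with y hy hy'
    rw [← hy]
    exact integral_congr_ae (hy'.mono fun x hx => hx.symm)
  have hint : Integrable (fun ω => u' (Z b ω, Z i ω) * v' (Z c ω, Z d ω)) μ := by
    refine ((memLp_pair hind hlaw hu hib.symm).integrable_mul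
      (memLp_pair hind hlaw hv hcd)).congr ?_
    filter_upwards [eu, ev] with ω h1 h2
    simp only [Pi.mul_apply, h1, h2]
  set Y : Ω → S × S × S := fun ω => (Z b ω, Z c ω, Z d ω)
  have mZ (i : ℕ) : AEMeasurable (Z i) μ := (hlaw i).aemeasurable
  have mY : AEMeasurable Y μ := (mZ b).prodMk ((mZ c).prodMk (mZ d))
  have hXY : IndepFun (Z i) Y μ := by
    have h := hind.indepFun_finset₀ {i} {b, c, d} (by simp [hib, hic, hid]) mZ
    exact h.comp (φ := fun f : ({i} : Finset ℕ) → S => f ⟨i, by simp⟩)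
      (ψ := fun f : ({b, c, d} : Finset ℕ) → S => (f ⟨b, by simp⟩, f ⟨c, by simp⟩, f ⟨d, by simp⟩))
      (by fun_prop) (by fun_prop)
  have hlawXY := hXY.hasLaw_prod (hlaw i) ⟨mY, rfl⟩
  have : IsProbabilityMeasure (μ.map Y) := Measure.isProbabilityMeasure_map mY
  set F : S × S × S × S → ℝ := fun q => u' (q.2.1, q.1) * v' q.2.2
  have mF : Measurable F := by fun_prop
  have hF : Integrable F (ρ.prod (μ.map Y)) := by
    rw [← hlawXY.map_eq, integrable_map_measure mF.aestronglyMeasurable hlawXY.aemeasurable]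
    exact hint
  have e1 : ∫ ω, u (Z b ω) (Z i ω) * v (Z c ω) (Z d ω) ∂μ = ∫ q, F q ∂(ρ.prod (μ.map Y)) := by
    rw [← hlawXY.integral_comp mF.aestronglyMeasurable]
    refine integral_congr_ae ?_
    filter_upwards [eu, ev] with ω h1 h2
    simp [F, Y, h1, h2]
  have hfst : (μ.map Y).map Prod.fst = ρ := by
    rw [AEMeasurable.map_map_of_aemeasurable (by fun_prop) mY]
    exact (hlaw b).map_eq
  rw [e1, integral_prod_symm _ hF]
  refine integral_eq_zero_of_ae ?_
  rw [← hfst] at hdeg'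
  filter_upwards [ae_of_ae_map (by fun_prop) hdeg'] with t ht
  simp only [F, integral_mul_const, Pi.zero_apply]
  rw [hfst] at ht
  rw [ht, zero_mul]

/-- For a symmetric degenerate core, the variables `w(Z_a, Z_b)` belonging to two different
unordered pairs of indices are orthogonal. -/
theorem integral_mul_eq_zero_of_ne (hind : iIndepFun Z μ) (hlaw : ∀ i, HasLaw (Z i) ρ μ)
    {w : S → S → ℝ} (hw : MemLp (fun p : S × S => w p.1 p.2) 2 (ρ.prod ρ))
    (hsymm : ∀ x y, w x y = w y x) (hdeg : ∀ᵐ y ∂ρ, ∫ x, w y x ∂ρ = 0) {p q : ℕ × ℕ}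
    (hp : p.1 ≠ p.2) (hq : q.1 ≠ q.2) (h1 : q ≠ p) (h2 : q ≠ p.swap) :
    ∫ ω, w (Z p.1 ω) (Z p.2 ω) * w (Z q.1 ω) (Z q.2 ω) ∂μ = 0 := by
  obtain ⟨a, b⟩ := p
  obtain ⟨c, d⟩ := q
  simp only [ne_eq, Prod.mk.injEq, Prod.swap_prod_mk] at *
  by_cases hb : b ≠ c ∧ b ≠ d
  · exact integral_mul_eq_zero_of_degenerate hind hlaw hw hw hdeg (Ne.symm hp) hb.1 hb.2 hq
  · have ha : a ≠ c ∧ a ≠ d := by grind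
    simp_rw [hsymm (Z a _) (Z b _)]
    exact integral_mul_eq_zero_of_degenerate hind hlaw hw hw hdeg hp ha.1 ha.2 hq

/-- Second moment bound for a sum of a degenerate symmetric core over a set of pairs of indices:
each pair is correlated only with itself and with its transpose. -/
theorem integral_sq_sum_le (hind : iIndepFun Z μ) (hlaw : ∀ i, HasLaw (Z i) ρ μ)
    {w : S → S → ℝ} (hw : MemLp (fun p : S × S => w p.1 p.2) 2 (ρ.prod ρ))
    (hsymm : ∀ x y, w x y = w y x) (hdeg : ∀ᵐ y ∂ρ, ∫ x, w y x ∂ρ = 0) (I : Finset (ℕ × ℕ))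
    (hI : ∀ p ∈ I, p.1 ≠ p.2) :
    ∫ ω, (∑ p ∈ I, w (Z p.1 ω) (Z p.2 ω)) ^ 2 ∂μ
      ≤ I.card * (2 * ∫ p, w p.1 p.2 ^ 2 ∂(ρ.prod ρ)) := by
  set C := ∫ p, w p.1 p.2 ^ 2 ∂(ρ.prod ρ)
  have hC : 0 ≤ C := integral_nonneg fun p => sq_nonneg _
  have hL (p) (hp : p ∈ I) : MemLp (fun ω => w (Z p.1 ω) (Z p.2 ω)) 2 μ :=
    memLp_pair hind hlaw hw (hI p hp)
  have hsq (p) (hp : p ∈ I) : ∫ ω, w (Z p.1 ω) (Z p.2 ω) ^ 2 ∂μ = C :=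
    (hasLaw_pair hind hlaw (hI p hp)).integral_comp (f := fun q : S × S => w q.1 q.2 ^ 2)
      (hw.1.pow 2)
  have hint (p) (hp : p ∈ I) (q) (hq : q ∈ I) :
      Integrable (fun ω => w (Z p.1 ω) (Z p.2 ω) * w (Z q.1 ω) (Z q.2 ω)) μ :=
    (hL p hp).integrable_mul (hL q hq)
  have hle (p) (hp : p ∈ I) (q) (hq : q ∈ I) :
      ∫ ω, w (Z p.1 ω) (Z p.2 ω) * w (Z q.1 ω) (Z q.2 ω) ∂μ ≤
        if q ∈ ({p, p.swap} : Finset (ℕ × ℕ)) then C else 0 := by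
    split_ifs with h
    · calc _ ≤ ∫ ω, (w (Z p.1 ω) (Z p.2 ω) ^ 2 + w (Z q.1 ω) (Z q.2 ω) ^ 2) / 2 ∂μ := by
            refine integral_mono (hint p hp q hq)
              (((hL p hp).integrable_sq.add (hL q hq).integrable_sq).div_const 2) fun ω => ?_
            nlinarith [sq_nonneg (w (Z p.1 ω) (Z p.2 ω) - w (Z q.1 ω) (Z q.2 ω))]
        _ = C := by
            rw [integral_div, integral_add (hL p hp).integrable_sq (hL q hq).integrable_sq,
              hsq p hp, hsq q hq]
            ring
    · simp only [Finset.mem_insert, Finset.mem_singleton, not_or] at h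
      exact (integral_mul_eq_zero_of_ne hind hlaw hw hsymm hdeg (hI p hp) (hI q hq) h.1 h.2).le
  have key (p) (hp : p ∈ I) :
      ∑ q ∈ I, ∫ ω, w (Z p.1 ω) (Z p.2 ω) * w (Z q.1 ω) (Z q.2 ω) ∂μ ≤ 2 * C := by
    refine (Finset.sum_le_sum (hle p hp)).trans ?_
    rw [← Finset.sum_filter, Finset.sum_const, nsmul_eq_mul]
    gcongr
    have : (I.filter (· ∈ ({p, p.swap} : Finset (ℕ × ℕ)))).card ≤ 2 :=
      (Finset.card_le_card fun q hq => (Finset.mem_filter.1 hq).2).trans Finset.card_le_two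
    exact_mod_cast this
  simp_rw [pow_two (Finset.sum _ _), Finset.sum_mul_sum]
  rw [integral_finsetSum _ fun p hp => integrable_finsetSum _ (hint p hp),
    ← nsmul_eq_mul]
  refine Finset.sum_le_card_nsmul _ _ _ fun p hp => ?_
  rw [integral_finsetSum _ (hint p hp)]
  exact key p hp

end Orthogonality

/-! ### Algebra of block averages -/

section BlockAlgebra

variable {S : Type*}

/-- The ordered pairs of distinct indices that lie in a common block, among the first `M` blocks
of size `B`. -/
def blockPairs (M B : ℕ) : Finset (ℕ × ℕ) :=
  (Finset.range M).biUnion fun i => (Finset.Ico (i * B) ((i + 1) * B)).offDiag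

theorem fst_ne_snd_of_mem_blockPairs {M B : ℕ} {p : ℕ × ℕ} (hp : p ∈ blockPairs M B) :
    p.1 ≠ p.2 := by
  simp only [blockPairs, Finset.mem_biUnion, Finset.mem_offDiag] at hp
  obtain ⟨i, -, -, -, h⟩ := hp
  exact h

theorem card_Ico_block (i B : ℕ) : (Finset.Ico (i * B) ((i + 1) * B)).card = B := by
  rw [Nat.card_Ico, add_mul, one_mul, Nat.add_sub_cancel_left]

theorem card_blockPairs_le (M B : ℕ) :
    ((blockPairs M B).card : ℝ) ≤ M * (B * ((B : ℝ) - 1)) := by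
  have h : (blockPairs M B).card ≤ M * (B * B - B) := by
    refine Finset.card_biUnion_le.trans
      ((Finset.sum_le_card_nsmul _ _ (B * B - B) fun i _ => ?_).trans (by simp))
    rw [Finset.offDiag_card, card_Ico_block]
  have h' : ((B * B - B : ℕ) : ℝ) = B * ((B : ℝ) - 1) := by
    rw [Nat.cast_sub (Nat.le_mul_self B)]
    push_cast
    ring
  rw [← h']
  exact_mod_cast h

theorem sum_sum_erase_eq_sum_offDiag (s : Finset ℕ) (f : ℕ → ℕ → ℝ) :
    ∑ a ∈ s, ∑ b ∈ s.erase a, f a b = ∑ p ∈ s.offDiag, f p.1 p.2 := by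
  rw [Finset.sum_sigma']
  refine Finset.sum_bij' (fun q _ => (q.1, q.2)) (fun p _ => ⟨p.1, p.2⟩) ?_ ?_ ?_ ?_ ?_ <;>
    simp +contextual [eq_comm]

theorem blockAverage_eq_sum_blockPairs (h : S → S → ℝ) (n B : ℕ) (z : ℕ → S) :
    blockAverage h n B z = 1 / ((n / B : ℕ) * ((B : ℝ) * ((B : ℝ) - 1))) *
      ∑ p ∈ blockPairs (n / B) B, h (z p.1) (z p.2) := by
  have hdisj : ((Finset.range (n / B) : Finset ℕ) : Set ℕ).PairwiseDisjoint
      fun i => (Finset.Ico (i * B) ((i + 1) * B)).offDiag := by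
    intro i _ j _ hij
    rw [Function.onFun, Finset.disjoint_left]
    rintro ⟨a, b⟩ h1 h2
    simp only [Finset.mem_offDiag, Finset.mem_Ico] at h1 h2
    have hi := Nat.div_eq_of_lt_le h1.1.1 h1.1.2
    have hj := Nat.div_eq_of_lt_le h2.1.1 h2.1.2
    exact hij (hi.symm.trans hj)
  simp only [blockAverage, blockStat]
  rw [← Finset.mul_sum, blockPairs, Finset.sum_biUnion hdisj, ← mul_assoc, one_div_mul_one_div]
  simp_rw [sum_sum_erase_eq_sum_offDiag _ fun a b => h (z a) (z b)]

/-- Algebraic form of the Hoeffding decomposition: if `h(z, z') = g(z) + g(z') - θ + w(z, z')`, then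
the block average of `h` is a rescaled partial sum of `g` plus the block average of `w`. -/
theorem blockAverage_eq_add (h w : S → S → ℝ) (g : S → ℝ) (θ : ℝ)
    (hw : ∀ x y, h x y = g x + g y - θ + w x y) {n B : ℕ} (hB : 2 ≤ B) (hn : 0 < n / B)
    (z : ℕ → S) :
    blockAverage h n B z = 2 / ((n / B * B : ℕ) : ℝ) * ∑ k ∈ Finset.range (n / B * B), g (z k) - θ
      + blockAverage w n B z := by
  have hB0 : (B : ℝ) ≠ 0 := by positivity
  have hB1 : (B : ℝ) - 1 ≠ 0 := by
    have : (2 : ℝ) ≤ B := by exact_mod_cast hB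
    linarith
  have hM : ((n / B : ℕ) : ℝ) ≠ 0 := by positivity
  have key (s : Finset ℕ) (hs : s.card = B) :
      ∑ a ∈ s, ∑ b ∈ s.erase a, h (z a) (z b) = 2 * ((B : ℝ) - 1) * ∑ a ∈ s, g (z a)
        - B * ((B : ℝ) - 1) * θ + ∑ a ∈ s, ∑ b ∈ s.erase a, w (z a) (z b) := by
    have h1 (a) (ha : a ∈ s) : ∑ b ∈ s.erase a, h (z a) (z b) =
        ((B : ℝ) - 2) * g (z a) + ∑ b ∈ s, g (z b) - ((B : ℝ) - 1) * θ
          + ∑ b ∈ s.erase a, w (z a) (z b) := by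
      simp_rw [hw]
      rw [Finset.sum_add_distrib, Finset.sum_sub_distrib, Finset.sum_add_distrib,
        ← Finset.add_sum_erase s _ ha]
      simp only [Finset.sum_const, Finset.card_erase_of_mem ha, hs, nsmul_eq_mul]
      rw [Nat.cast_sub (by omega)]
      push_cast
      ring
    rw [Finset.sum_congr rfl h1]
    simp only [Finset.sum_add_distrib, Finset.sum_sub_distrib, Finset.sum_const, hs, nsmul_eq_mul,
      ← Finset.mul_sum]
    ring
  have hsum (M : ℕ) : ∑ i ∈ Finset.range M, ∑ a ∈ Finset.Ico (i * B) ((i + 1) * B), g (z a) =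
      ∑ k ∈ Finset.range (M * B), g (z k) := by
    induction M with
    | zero => simp
    | succ M ih =>
      rw [Finset.sum_range_succ, ih, Finset.sum_range_add_sum_Ico _ (by gcongr; omega)]
  simp only [blockAverage, blockStat, key _ (card_Ico_block _ B), ← Finset.mul_sum,
    Finset.sum_add_distrib, Finset.sum_sub_distrib, hsum, Finset.sum_const, Finset.card_range,
    nsmul_eq_mul]
  push_cast
  field_simp

end BlockAlgebra

/-! ### Hoeffding decomposition -/

section Projection

variable {S : Type*} [MeasurableSpace S] {ρ : Measure S} [IsProbabilityMeasure ρ]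

/-- The projection `z ↦ E h(z, z')` of a square integrable core is square integrable, by Jensen's
inequality. -/
theorem memLp_projection {h : S → S → ℝ}
    (hh : MemLp (fun p : S × S => h p.1 p.2) 2 (ρ.prod ρ)) :
    MemLp (fun z => ∫ z', h z z' ∂ρ) 2 ρ := by
  have hm : AEStronglyMeasurable (fun z => ∫ z', h z z' ∂ρ) ρ := hh.1.integral_prod_right'
  refine (memLp_two_iff_integrable_sq hm).2 ?_
  refine hh.integrable_sq.integral_prod_left.mono' (hm.pow 2) ?_
  filter_upwards [hh.1.prodMk_left, hh.integrable_sq.prod_right_ae] with z h1 h2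
  have hz : MemLp (h z) 2 ρ := (memLp_two_iff_integrable_sq h1).2 h2
  have hv := variance_nonneg (h z) ρ
  rw [variance_eq_sub hz] at hv
  rw [Real.norm_of_nonneg (sq_nonneg _)]
  simpa using hv

/-- The degenerate part in the Hoeffding decomposition of the core `h`: what remains after
subtracting the projections on each of the two variables. -/
noncomputable def degeneratePart (h : S → S → ℝ) (ρ : Measure S) (x y : S) : ℝ :=
  h x y - ∫ z, h x z ∂ρ - ∫ z, h y z ∂ρ + ∫ z, ∫ z', h z z' ∂ρ ∂ρ

theorem memLp_degeneratePart {h : S → S → ℝ}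
    (hh : MemLp (fun p : S × S => h p.1 p.2) 2 (ρ.prod ρ)) :
    MemLp (fun p : S × S => degeneratePart h ρ p.1 p.2) 2 (ρ.prod ρ) :=
  ((hh.sub ((memLp_projection hh).comp_fst ρ)).sub ((memLp_projection hh).comp_snd ρ)).add
    (memLp_const _)

theorem integral_degeneratePart {h : S → S → ℝ}
    (hh : MemLp (fun p : S × S => h p.1 p.2) 2 (ρ.prod ρ)) :
    ∀ᵐ y ∂ρ, ∫ x, degeneratePart h ρ y x ∂ρ = 0 := by
  have hg := (memLp_projection hh).integrable one_le_two
  filter_upwards [(hh.integrable one_le_two).prod_right_ae] with y hy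
  have h1 : Integrable (fun x => h y x - ∫ z, h y z ∂ρ) ρ := hy.sub (integrable_const _)
  have h2 : Integrable (fun x => h y x - ∫ z, h y z ∂ρ - ∫ z, h x z ∂ρ) ρ := h1.sub hg
  simp only [degeneratePart]
  rw [integral_add h2 (integrable_const _), integral_sub h1 hg,
    integral_sub hy (integrable_const _)]
  simp

end Projection

/-! ### Convergence in probability and asymptotics of the sample sizes -/

section Limits

variable {Ω : Type*} [MeasurableSpace Ω] {μ : Measure Ω} [IsProbabilityMeasure μ]

/-- Convergence to zero in quadratic mean implies convergence to zero in probability. -/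
theorem tendstoInMeasure_zero_of_integral_sq {f : ℕ → Ω → ℝ} {b : ℕ → ℝ}
    (hf : ∀ᶠ j in atTop, MemLp (f j) 2 μ ∧ ∫ ω, f j ω ^ 2 ∂μ ≤ b j)
    (hb : Tendsto b atTop (𝓝 0)) : TendstoInMeasure μ f atTop 0 := by
  rw [tendstoInMeasure_iff_measureReal_norm]
  intro ε hε
  have hb' : Tendsto (fun j => b j / ε ^ 2) atTop (𝓝 0) := by simpa using hb.div_const (ε ^ 2)
  refine squeeze_zero' (Eventually.of_forall fun j => measureReal_nonneg) ?_ hb'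
  filter_upwards [hf] with j hj
  rw [le_div_iff₀ (by positivity), mul_comm]
  refine le_trans ?_ ((mul_meas_ge_le_integral_of_nonneg (Eventually.of_forall fun ω => sq_nonneg _)
    hj.1.integrable_sq (ε ^ 2)).trans hj.2)
  refine mul_le_mul_of_nonneg_left (measureReal_mono fun ω hω => ?_) (sq_nonneg ε)
  simp only [Set.mem_ofPred_eq, Pi.zero_apply, sub_zero, Real.norm_eq_abs] at hω ⊢
  rw [← sq_abs (f j ω)]
  gcongr

theorem tendstoInMeasure_const {c : ℕ → ℝ} {a : ℝ} (hc : Tendsto c atTop (𝓝 a)) :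
    TendstoInMeasure μ (fun j (_ : Ω) => c j) atTop (fun _ => a) :=
  tendstoInMeasure_of_tendsto_ae (fun _ => aestronglyMeasurable_const)
    (Eventually.of_forall fun _ => hc)

variable {n B : ℕ → ℕ}

theorem tendsto_blockCount (hnB : Tendsto (fun j => (n j : ℝ) / (B j : ℝ)) atTop atTop) :
    Tendsto (fun j => n j / B j) atTop atTop := by
  simpa only [Function.comp_def, Nat.floor_div_eq_div] using tendsto_nat_floor_atTop.comp hnB

/-- Discarding the incomplete block does not change the sample size asymptotically. -/
theorem tendsto_sampleSize_ratio (hB : Tendsto B atTop atTop)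
    (hnB : Tendsto (fun j => (n j : ℝ) / (B j : ℝ)) atTop atTop) :
    Tendsto (fun j => (n j : ℝ) / ((n j / B j * B j : ℕ) : ℝ)) atTop (𝓝 1) := by
  have hM := tendsto_blockCount hnB
  have h1 : Tendsto (fun j => 1 + 1 / ((n j / B j : ℕ) : ℝ)) atTop (𝓝 (1 + 0)) :=
    tendsto_const_nhds.add (tendsto_one_div_atTop_nhds_zero_nat.comp hM)
  rw [add_zero] at h1
  refine tendsto_of_tendsto_of_tendsto_of_le_of_le' tendsto_const_nhds h1 ?_ ?_
  · filter_upwards [hM.eventually_gt_atTop 0, hB.eventually_gt_atTop 0] with j hj hj'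
    rw [one_le_div (by positivity)]
    exact_mod_cast Nat.div_mul_le_self _ _
  · filter_upwards [hM.eventually_gt_atTop 0, hB.eventually_gt_atTop 0] with j hj hj'
    have hlt : (n j : ℝ) ≤ (n j / B j : ℕ) * B j + B j := by
      exact_mod_cast (Nat.lt_div_mul_add hj').le
    rw [div_le_iff₀ (by positivity)]
    push_cast
    field_simp
    linarith

end Limits

/-! ### Asymptotic normality of block averages -/

section BlockCLT

variable {S Ω : Type*} [MeasurableSpace S] [MeasurableSpace Ω] {ρ : Measure S}
  [IsProbabilityMeasure ρ] {μ : Measure Ω} [IsProbabilityMeasure μ] {Z : ℕ → Ω → S} {n B : ℕ → ℕ}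

theorem memLp_blockAverage (hind : iIndepFun Z μ) (hlaw : ∀ i, HasLaw (Z i) ρ μ)
    {h : S → S → ℝ} (hh : MemLp (fun p : S × S => h p.1 p.2) 2 (ρ.prod ρ)) (m b : ℕ) :
    MemLp (fun ω => blockAverage h m b fun a => Z a ω) 2 μ := by
  simp_rw [blockAverage_eq_sum_blockPairs]
  exact (memLp_finsetSum _ fun p hp =>
    memLp_pair hind hlaw hh (fst_ne_snd_of_mem_blockPairs hp)).const_mul _

/-- The degenerate part of the block average is negligible at the scale `√n`: its variance is of
order `1 / (n B)`, and `B → ∞`. -/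
theorem tendstoInMeasure_sqrt_mul_blockAverage (hind : iIndepFun Z μ)
    (hlaw : ∀ i, HasLaw (Z i) ρ μ) {w : S → S → ℝ}
    (hw : MemLp (fun p : S × S => w p.1 p.2) 2 (ρ.prod ρ)) (hsymm : ∀ x y, w x y = w y x)
    (hdeg : ∀ᵐ y ∂ρ, ∫ x, w y x ∂ρ = 0) (hB : Tendsto B atTop atTop)
    (hnB : Tendsto (fun j => (n j : ℝ) / (B j : ℝ)) atTop atTop) :
    TendstoInMeasure μ (fun j ω => √(n j : ℝ) * blockAverage w (n j) (B j) fun a => Z a ω)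
      atTop 0 := by
  set C := ∫ p, w p.1 p.2 ^ 2 ∂(ρ.prod ρ)
  have hC : 0 ≤ C := integral_nonneg fun p => sq_nonneg _
  have hB' : Tendsto (fun j => 1 / ((B j : ℝ) - 1)) atTop (𝓝 0) := by
    simp_rw [one_div]
    exact tendsto_inv_atTop_zero.comp
      (tendsto_atTop_add_const_right _ (-1) (tendsto_natCast_atTop_atTop.comp hB))
  refine tendstoInMeasure_zero_of_integral_sq
    (b := fun j => (n j : ℝ) / ((n j / B j * B j : ℕ) : ℝ) * (1 / ((B j : ℝ) - 1)) * (2 * C)) ?_ ?_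
  · filter_upwards [(tendsto_blockCount hnB).eventually_gt_atTop 0,
      hB.eventually_ge_atTop 2] with j hM hj
    refine ⟨(memLp_blockAverage hind hlaw hw _ _).const_mul _, ?_⟩
    simp_rw [blockAverage_eq_sum_blockPairs, mul_pow, Real.sq_sqrt (Nat.cast_nonneg (n j))]
    rw [integral_const_mul, integral_const_mul]
    have hbound := (integral_sq_sum_le hind hlaw hw hsymm hdeg (blockPairs (n j / B j) (B j))
      fun p hp => fst_ne_snd_of_mem_blockPairs hp).trans
      (mul_le_mul_of_nonneg_right (card_blockPairs_le _ _) (by positivity))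
    have hB1 : (0 : ℝ) < (B j : ℝ) - 1 := by
      have : (2 : ℝ) ≤ B j := by exact_mod_cast hj
      linarith
    have hB0 : (0 : ℝ) < B j := by linarith
    have hM0 : (0 : ℝ) < (n j / B j : ℕ) := by exact_mod_cast hM
    refine (mul_le_mul_of_nonneg_left (mul_le_mul_of_nonneg_left hbound (sq_nonneg _))
      (Nat.cast_nonneg _)).trans_eq ?_
    push_cast
    field_simp
    rfl
  · simpa using ((tendsto_sampleSize_ratio hB hnB).mul hB').mul_const (2 * C)

/-- Central limit theorem for block averages of U-statistics with a symmetric square integrable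
core. -/
theorem tendstoInDistribution_blockAverage (hind : iIndepFun Z μ)
    (hlaw : ∀ i, HasLaw (Z i) ρ μ) {h : S → S → ℝ}
    (hh : MemLp (fun p : S × S => h p.1 p.2) 2 (ρ.prod ρ)) (hsymm : ∀ x y, h x y = h y x)
    (hB : Tendsto B atTop atTop)
    (hnB : Tendsto (fun j => (n j : ℝ) / (B j : ℝ)) atTop atTop) :
    TendstoInDistribution
      (fun j ω => √(n j : ℝ) *
        (blockAverage h (n j) (B j) (fun a => Z a ω) - ∫ z, ∫ z', h z z' ∂ρ ∂ρ))
      atTop (id : ℝ → ℝ) (fun _ => μ) (gaussianReal 0 (sigmaSq h ρ).toNNReal) := by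
  set θ := ∫ z, ∫ z', h z z' ∂ρ ∂ρ
  set g : S → ℝ := fun z => ∫ z', h z z' ∂ρ
  set w := degeneratePart h ρ
  have hg : MemLp g 2 ρ := memLp_projection hh
  have hgm (i : ℕ) : AEStronglyMeasurable g (μ.map (Z i)) := by
    rw [(hlaw i).map_eq]
    exact hg.1
  have hgZ (i : ℕ) : MemLp (fun ω => g (Z i ω)) 2 μ :=
    (memLp_map_measure_iff (hgm i) (hlaw i).aemeasurable).1 (by rwa [(hlaw i).map_eq])
  have hmean : ∫ ω, g (Z 0 ω) ∂μ = θ := (hlaw 0).integral_comp hg.1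
  have hvar : 4 * Var[fun ω => g (Z 0 ω); μ] = sigmaSq h ρ := by
    rw [variance_eq_sub (hgZ 0), hmean, sigmaSq]
    congr 2
    exact (hlaw 0).integral_comp (f := fun z => g z ^ 2) (hg.1.pow 2)
  -- The limit in the classical central limit theorem for `g(Z_k)` is realized as half of the
  -- Gaussian variable on the canonical space.
  have hY : HasLaw (fun x : ℝ => x / 2) (gaussianReal 0 Var[fun ω => g (Z 0 ω); μ].toNNReal)
      (gaussianReal 0 (sigmaSq h ρ).toNNReal) := by
    have h1 := gaussianReal_div_const
      (HasLaw.id (μ := gaussianReal 0 (sigmaSq h ρ).toNNReal)) 2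
    convert! h1 using 2
    · simp
    · ext
      rw [← hvar]
      have := variance_nonneg (fun ω => g (Z 0 ω)) μ
      simp only [NNReal.coe_div, NNReal.coe_mk, Real.coe_toNNReal _ this,
        Real.coe_toNNReal _ (mul_nonneg zero_le_four this)]
      ring
  have hclt := tendstoInDistribution_inv_sqrt_mul_sum_sub hY (X := fun i ω => g (Z i ω)) (hgZ 0)
    (hind.comp₀ (fun _ => g) (fun i => (hlaw i).aemeasurable) fun i => (hgm i).aemeasurable)
    (fun i => ⟨(hgZ i).1.aemeasurable, (hgZ 0).1.aemeasurable, by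
      change μ.map (g ∘ Z i) = μ.map (g ∘ Z 0)
      rw [← AEMeasurable.map_map_of_aemeasurable (hgm i).aemeasurable (hlaw i).aemeasurable,
        ← AEMeasurable.map_map_of_aemeasurable (hgm 0).aemeasurable (hlaw 0).aemeasurable,
        (hlaw i).map_eq, (hlaw 0).map_eq]⟩)
  rw [hmean] at hclt
  -- `N j` is the number of observations that lie in complete blocks.
  set N : ℕ → ℕ := fun j => n j / B j * B j
  have hN : Tendsto N atTop atTop := (tendsto_blockCount hnB).atTop_mul_atTop₀ hB
  set T : ℕ → Ω → ℝ := fun m ω => (√m)⁻¹ * (∑ k ∈ Finset.range m, g (Z k ω) - m * θ)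
  have hT : TendstoInDistribution (fun j => T (N j)) atTop (fun x : ℝ => x / 2) (fun _ => μ)
      (gaussianReal 0 (sigmaSq h ρ).toNNReal) :=
    ⟨fun j => hclt.forall_aemeasurable (N j), hclt.aemeasurable_limit, hclt.tendsto.comp hN⟩
  set c : ℕ → ℝ := fun j => 2 * √((n j : ℝ) / (N j : ℝ))
  have hc : Tendsto c atTop (𝓝 2) := by
    have h1 := ((tendsto_sampleSize_ratio hB hnB).sqrt).const_mul 2
    rwa [Real.sqrt_one, mul_one] at h1
  -- Slutsky's theorem replaces the normalization `√N` of the partial sums by `√n`.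
  have hcT := hT.continuous_comp_prodMk_of_tendstoInMeasure_const
    (g := fun p : ℝ × ℝ => p.1 * p.2) (by fun_prop) (tendstoInMeasure_const hc)
    (fun _ => aemeasurable_const)
  set U : ℕ → Ω → ℝ := fun j ω => √(n j : ℝ) *
    (blockAverage h (n j) (B j) (fun a => Z a ω) - θ)
  have hU (j) : AEMeasurable (U j) μ :=
    ((memLp_blockAverage hind hlaw hh _ _).1.aemeasurable.sub_const _).const_mul _
  -- The difference is exactly the degenerate part as soon as there is a complete block of size
  -- at least two; for the other `j` the statistic has a zero denominator.
  have hrem : TendstoInMeasure μ (U - fun j ω => T (N j) ω * c j) atTop 0 := by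
    have hdeg := tendstoInMeasure_sqrt_mul_blockAverage hind hlaw (memLp_degeneratePart hh)
      (fun x y => by simp only [degeneratePart, hsymm x y]; ring) (integral_degeneratePart hh)
      hB hnB
    refine hdeg.congr' ?_ EventuallyEq.rfl
    filter_upwards [(tendsto_blockCount hnB).eventually_gt_atTop 0,
      hB.eventually_ge_atTop 2] with j hM hj
    refine Eventually.of_forall fun ω => ?_
    have hN0 : (0 : ℝ) < N j := by
      have : 0 < N j := Nat.mul_pos hM (by omega)
      exact_mod_cast this
    have hdec : blockAverage h (n j) (B j) (fun a => Z a ω) =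
        2 / (N j : ℝ) * ∑ k ∈ Finset.range (N j), g (Z k ω) - θ
          + blockAverage w (n j) (B j) (fun a => Z a ω) :=
      blockAverage_eq_add h w g θ
        (fun x y => by simp only [w, degeneratePart, g, θ]; ring) hj hM fun a => Z a ω
    simp only [Pi.sub_apply, U, T, c]
    rw [hdec, Real.sqrt_div (Nat.cast_nonneg _)]
    have hs : (N j : ℝ) = √(N j : ℝ) * √(N j : ℝ) := (Real.mul_self_sqrt hN0.le).symm
    have hs0 : √(N j : ℝ) ≠ 0 := (Real.sqrt_pos.2 hN0).ne'
    generalize √(N j : ℝ) = s at hs hs0 ⊢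
    rw [hs]
    field_simp
    ring
  have hfin := tendstoInDistribution_of_tendstoInMeasure_sub U _ hcT hrem hU
  exact hfin.congr (fun _ => EventuallyEq.rfl) (Eventually.of_forall fun x => by simp)

end BlockCLT

end BTest

theorem mainTheorem2
    {X : Type*} [MeasurableSpace X]
    {H : Type*} [NormedAddCommGroup H] [InnerProductSpace ℝ H] [CompleteSpace H] [RKHS ℝ H X ℝ]
    (P Q : Measure X) [IsProbabilityMeasure P] [IsProbabilityMeasure Q]
    (hP : BTest.HasMeanEmbedding H P) (hQ : BTest.HasMeanEmbedding H Q)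
    (hPQ : P ≠ Q)
    (h_sq : MemLp (fun p : (X × X) × (X × X) => BTest.mmdCore H p.1 p.2) 2
      ((P.prod Q).prod (P.prod Q)))
    (h_pos : 0 < ∫ p : (X × X) × (X × X), BTest.mmdCore H p.1 p.2 ^ 2
      ∂((P.prod Q).prod (P.prod Q)))
    {Ω : Type*} [MeasurableSpace Ω] (μ : Measure Ω) [IsProbabilityMeasure μ]
    (Z : ℕ → Ω → X × X) (hZ_indep : iIndepFun Z μ) (hZ_law : ∀ i, HasLaw (Z i) (P.prod Q) μ)
    (n B : ℕ → ℕ) (hB : Tendsto B atTop atTop)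
    (hnB : Tendsto (fun j => (n j : ℝ) / (B j : ℝ)) atTop atTop) :
    TendstoInDistribution
      (fun j ω => √(n j : ℝ) *
        (BTest.blockAverage (BTest.mmdCore H) (n j) (B j) (fun a => Z a ω) - BTest.mmdSq H P Q))
      atTop (id : ℝ → ℝ) (fun _ => μ)
      (gaussianReal 0 (BTest.sigmaSq (BTest.mmdCore H) (P.prod Q)).toNNReal) := by
  rw [← BTest.integral_integral_mmdCore hP hQ]
  exact BTest.tendstoInDistribution_blockAverage hZ_indep hZ_law h_sq BTest.mmdCore_comm hB hnB
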